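/- Let $\mathcal{M}$ be a $d$-dimensional smooth manifold carrying a hyperelastic body, i.e. an energy density $W:T^*\mathcal{M}\otimes\mathbb{R}^d\to(-\infty,\infty]$ and a volume form $\mathrm{Vol}$ (orienting $\mathcal{M}$). Suppose the body is represented as a smooth uniform body $(\mathcal{M},\{U_\alpha,P_\alpha\}_\alpha,\mathcal{W})$: $(U_\alpha)$ is an open cover of $\mathcal{M}$; each $P_\alpha:TU_\alpha\to\mathbb{R}^d$ is a smooth $\mathbb{R}^d$-valued one-form such that, for $p\in U_\alpha$, $P_\alpha(p):T_p\mathcal{M}\to\mathbb{R}^d$ is an isomorphism with $\mathrm{Vol}=P_\alpha^*dx$; and $\mathcal{W}:\mathbb{R}^d\otimes\mathbb{R}^d\to(-\infty,\infty]$ satisfies $W_p(A)=\mathcal{W}(A\circ P_\alpha(p)^{-1})$ for all $p\in U_\alpha$ and $A\in T_p^*\mathcal{M}\otimes\mathbb{R}^d$. Let $$\mathcal{G}=\{g\in \mathrm{GL}(d) : \mathcal{W}(B\circ g)=\mathcal{W}(B)\ \text{for all } B\in\mathbb{R}^d\otimes\mathbb{R}^d\}$$ be the symmetry group of $\mathcal{W}$,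 and assume that $\mathcal{W}$ is undistorted, i.e. $\mathcal{G}\subset \mathrm{SO}(d)$. Then $G_p(X,Y)=P_\alpha(p)X\cdot P_\alpha(p)Y$ ($p\in U_\alpha$) is a well-defined Riemannian metric on $\mathcal{M}$. Assume that the body has discrete defects, i.e. that $dP_\alpha=0$ for every $\alpha$. Let $\nabla$ be the Levi-Civita connection of $G$ (which exists), and let $\gamma:[0,1]\to\mathcal{M}$ be a piecewise smooth closed curve based at $p$. Then parallel transport of $\nabla$ along $\gamma$ is a well-defined linear map $c_\gamma:T_p\mathcal{M}\to T_p\mathcal{M}$ (the holonomy, called the disclination content of $\gamma$), and for every $\alpha$ with $p\in U_\alpha$, $$P_\alpha(p)\circ c_\gamma\circ P_\alpha(p)^{-1}\in\mathcal{G}.$$ -/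

import Mathlib

open Set Bundle
open scoped Manifold ContDiff

noncomputable section

namespace DefectBody

/-- The Euclidean space `ℝᵈ`. -/
abbrev E (d : ℕ) := EuclideanSpace ℝ (Fin d)

/-! ### Hyperelastic bodies, archetypes and their symmetry groups -/

/-- A hyperelastic body on the `d`-dimensional smooth manifold `M`: an energy density
`W : T^*M ⊗ ℝᵈ → (-∞, ∞]` and a volume form, i.e. a smooth nowhere vanishing `d`-form (which also
fixes the orientation of `M`). Smoothness of the form is tested on smooth local vector fields. -/
structure HyperelasticBody (d : ℕ) (M : Type*) [TopologicalSpace M] [ChartedSpace (E d) M]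
    [IsManifold (𝓡 d) ∞ M] where
  /-- the energy density (constitutive relation) -/
  W : ∀ p : M, (TangentSpace (𝓡 d) p →L[ℝ] E d) → WithTop ℝ
  /-- the volume form -/
  vol : ∀ p : M, (TangentSpace (𝓡 d) p) [⋀^Fin d]→L[ℝ] ℝ
  vol_ne_zero : ∀ p, vol p ≠ 0
  vol_smooth : ∀ (p : M) (X : Fin d → ∀ q : M, TangentSpace (𝓡 d) q),
    (∀ i, ContMDiffAt (𝓡 d) (𝓡 d).tangent ∞ (fun q ↦ (⟨q, X i q⟩ : TangentBundle (𝓡 d) M)) p) →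
    ContMDiffAt (𝓡 d) 𝓘(ℝ, ℝ) ∞ (fun q ↦ vol q (fun i ↦ X i q)) p

/-- An archetype: a function `𝒲 : ℝᵈ ⊗ ℝᵈ → (-∞, ∞]`. -/
abbrev Archetype (d : ℕ) := (E d →L[ℝ] E d) → WithTop ℝ

/-- The symmetry group of an archetype: all `g ∈ GL(d)` with `𝒲 (B ∘ g) = 𝒲 B` for all `B`. -/
def symmetryGroup {d : ℕ} (𝒲 : Archetype d) : Subgroup (E d ≃L[ℝ] E d) where
  carrier := {g | ∀ B : E d →L[ℝ] E d, 𝒲 (B ∘L (g : E d →L[ℝ] E d)) = 𝒲 B}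
  one_mem' := fun _ ↦ rfl
  mul_mem' := by
    intro g h hg hh B
    have h1 := hh (B ∘L (g : E d →L[ℝ] E d))
    rw [hg B] at h1
    exact h1
  inv_mem' := by
    intro g hg B
    have h1 := hg (B ∘L ((g⁻¹ : E d ≃L[ℝ] E d) : E d →L[ℝ] E d))
    rw [← h1]
    congr 1
    ext1 x
    exact congrArg B (g.symm_apply_apply x)

/-- The matrix of an element of `GL(d)` in the standard basis. -/
def stdMatrix {d : ℕ} (g : E d ≃L[ℝ] E d) : Matrix (Fin d) (Fin d) ℝ :=
  LinearMap.toMatrix (EuclideanSpace.basisFun (Fin d) ℝ).toBasis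
    (EuclideanSpace.basisFun (Fin d) ℝ).toBasis (g : E d →L[ℝ] E d).toLinearMap

/-- An archetype is (solid and) undistorted if its symmetry group is contained in `SO(d)`. -/
def Archetype.IsUndistorted {d : ℕ} (𝒲 : Archetype d) : Prop :=
  ∀ g ∈ symmetryGroup 𝒲, stdMatrix g ∈ Matrix.specialOrthogonalGroup (Fin d) ℝ

variable {d : ℕ} {M : Type*} [TopologicalSpace M] [ChartedSpace (E d) M]
  [IsManifold (𝓡 d) ∞ M]

/-- A representation `(M, {U_α, P_α}, 𝒲)` of a hyperelastic body as a smooth uniform body.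
Only the values of the reference maps `P α p` with `p ∈ U α` carry information. -/
structure UniformRepresentation (B : HyperelasticBody d M) (ι : Type*) where
  /-- the reference neighborhoods -/
  U : ι → Set M
  isOpen_U : ∀ α, IsOpen (U α)
  exists_mem_U : ∀ p : M, ∃ α, p ∈ U α
  /-- the reference maps `P_α(p) : T_pM ≅ ℝᵈ` -/
  P : ι → ∀ p : M, TangentSpace (𝓡 d) p ≃L[ℝ] E d
  /-- `P_α : TU_α → ℝᵈ` is smooth -/
  smooth_P : ∀ α, ContMDiffOn (𝓡 d).tangent 𝓘(ℝ, E d) ∞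
    (fun v : TangentBundle (𝓡 d) M ↦ P α v.proj v.2) {v | v.proj ∈ U α}
  /-- `Vol = P_α^* dx` -/
  vol_eq : ∀ α, ∀ p ∈ U α, ∀ v : Fin d → TangentSpace (𝓡 d) p,
    B.vol p v = (EuclideanSpace.basisFun (Fin d) ℝ).toBasis.det (fun i ↦ P α p (v i))
  /-- the archetype -/
  𝒲 : Archetype d
  /-- `W_p(A) = 𝒲(A ∘ P_α(p)⁻¹)` -/
  W_eq : ∀ α, ∀ p ∈ U α, ∀ A : TangentSpace (𝓡 d) p →L[ℝ] E d,
    B.W p A = 𝒲 (A ∘L ((P α p).symm : E d →L[ℝ] TangentSpace (𝓡 d) p))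

/-- The `ℝᵈ`-valued one-form `θ` is closed on `U`: `dθ(X, Y) = X(θ(Y)) - Y(θ(X)) - θ([X, Y])`
vanishes at every point of `U`, for all vector fields `X`, `Y` differentiable there. -/
def IsClosedFormOn (θ : ∀ p : M, TangentSpace (𝓡 d) p →L[ℝ] E d) (U : Set M) : Prop :=
  ∀ p ∈ U, ∀ X Y : ∀ q : M, TangentSpace (𝓡 d) q,
    MDifferentiableAt (𝓡 d) (𝓡 d).tangent (fun q ↦ (⟨q, X q⟩ : TangentBundle (𝓡 d) M)) p →
    MDifferentiableAt (𝓡 d) (𝓡 d).tangent (fun q ↦ (⟨q, Y q⟩ : TangentBundle (𝓡 d) M)) p →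
    mvfderiv (𝓡 d) (fun q ↦ θ q (Y q)) p (X p) - mvfderiv (𝓡 d) (fun q ↦ θ q (X q)) p (Y p)
      - θ p (VectorField.mlieBracket (𝓡 d) X Y p) = 0

namespace UniformRepresentation

variable {B : HyperelasticBody d M} {ι : Type*} (R : UniformRepresentation B ι)

/-- A body with discrete defects: every reference map is a closed form. -/
def HasDiscreteDefects : Prop :=
  ∀ α, IsClosedFormOn (fun p ↦ (R.P α p : TangentSpace (𝓡 d) p →L[ℝ] E d)) (R.U α)

/-- The intrinsic Riemannian metric `G_p(X, Y) = P_α(p)X · P_α(p)Y`, where `α` is some index with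
`p ∈ U α`; see `metric_eq` for the independence of `α`. -/
def metric (p : M) (X Y : TangentSpace (𝓡 d) p) : ℝ :=
  inner ℝ (R.P (R.exists_mem_U p).choose p X) (R.P (R.exists_mem_U p).choose p Y)

theorem transition_mem {α β : ι} {p : M} (hα : p ∈ R.U α) (hβ : p ∈ R.U β) :
    (R.P β p).symm.trans (R.P α p) ∈ symmetryGroup R.𝒲 := by
  intro A
  have h1 := R.W_eq β p hβ (A ∘L (R.P α p : TangentSpace (𝓡 d) p →L[ℝ] E d))
  have h2 := R.W_eq α p hα (A ∘L (R.P α p : TangentSpace (𝓡 d) p →L[ℝ] E d))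
  have h3 : (A ∘L (R.P α p : TangentSpace (𝓡 d) p →L[ℝ] E d)) ∘L
      ((R.P α p).symm : E d →L[ℝ] TangentSpace (𝓡 d) p) = A := by
    ext1 x
    exact congrArg A ((R.P α p).apply_symm_apply x)
  rw [h3] at h2
  exact h1.symm.trans h2

/-- For undistorted archetypes the intrinsic metric does not depend on the reference map. -/
theorem metric_eq (h𝒲 : R.𝒲.IsUndistorted) {α : ι} {p : M} (hα : p ∈ R.U α)
    (X Y : TangentSpace (𝓡 d) p) : R.metric p X Y = inner ℝ (R.P α p X) (R.P α p Y) := by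
  have key : ∀ g ∈ symmetryGroup R.𝒲, ∀ x y : E d, inner ℝ (g x) (g y) = inner ℝ x y := by
    intro g hg x y
    have h1 := (Matrix.mem_orthogonalGroup_iff' _ _).1
      (Matrix.mem_specialOrthogonalGroup_iff.1 (h𝒲 g hg)).1
    have h2 : LinearMap.adjoint (g : E d →L[ℝ] E d).toLinearMap ∘ₗ
        (g : E d →L[ℝ] E d).toLinearMap = LinearMap.id := by
      apply (LinearMap.toMatrix (EuclideanSpace.basisFun (Fin d) ℝ).toBasis
        (EuclideanSpace.basisFun (Fin d) ℝ).toBasis).injective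
      rw [LinearMap.toMatrix_comp _ (EuclideanSpace.basisFun (Fin d) ℝ).toBasis,
        LinearMap.toMatrix_adjoint, LinearMap.toMatrix_id]
      exact h1
    calc inner ℝ (g x) (g y)
        = inner ℝ (LinearMap.adjoint (g : E d →L[ℝ] E d).toLinearMap (g x)) y :=
          (LinearMap.adjoint_inner_left _ _ _).symm
      _ = inner ℝ x y := congrArg (inner ℝ · y) (LinearMap.congr_fun h2 x)
  have h := key _ (R.transition_mem (R.exists_mem_U p).choose_spec hα) (R.P α p X) (R.P α p Y)
  simpa [metric] using h

end UniformRepresentation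

/-! ### The Levi-Civita connection and its parallel transport -/

variable (d M) in
/-- Affine connections on `M`, i.e. covariant derivatives on its tangent bundle
(`nabla σ p v` is `(∇_v σ)(p)`). -/
abbrev AffineConnection : Type _ :=
  CovariantDerivative (𝓡 d) (E d) (TangentSpace (𝓡 d) : M → Type _)

/-- `∇` is a Levi-Civita connection of the metric `G`: it is torsion-free and
`X(G(σ, τ)) = G(∇_X σ, τ) + G(σ, ∇_X τ)`. -/
def IsLeviCivita (G : ∀ p : M, TangentSpace (𝓡 d) p → TangentSpace (𝓡 d) p → ℝ)
    (nabla : AffineConnection d M) : Prop :=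
  nabla.torsion = 0 ∧
  ∀ (p : M) (v : TangentSpace (𝓡 d) p) (σ τ : ∀ q : M, TangentSpace (𝓡 d) q),
    MDifferentiableAt (𝓡 d) (𝓡 d).tangent (fun q ↦ (⟨q, σ q⟩ : TangentBundle (𝓡 d) M)) p →
    MDifferentiableAt (𝓡 d) (𝓡 d).tangent (fun q ↦ (⟨q, τ q⟩ : TangentBundle (𝓡 d) M)) p →
    mvfderiv (𝓡 d) (fun q ↦ G q (σ q) (τ q)) p v
      = G p (nabla σ p v) (τ p) + G p (σ p) (nabla τ p v)

variable (d) in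
/-- `γ|_[0,1]` is a piecewise smooth closed curve based at `p`: it is smooth on each of the closed
intervals of some partition `0 = t₀ < t₁ < ⋯ < tₙ = 1`. -/
def IsPiecewiseSmoothLoop (γ : ℝ → M) (p : M) : Prop :=
  (∃ (n : ℕ) (t : ℕ → ℝ), StrictMono t ∧ t 0 = 0 ∧ t n = 1 ∧
    ∀ i < n, ContMDiffOn 𝓘(ℝ, ℝ) (𝓡 d) ∞ γ (Icc (t i) (t (i + 1)))) ∧ γ 0 = p ∧ γ 1 = p

/-- The covariant derivative `∇_{γ'} V` at time `t` of a vector field `V` along the curve `γ`.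
Let `e` be the local trivialization of `TM` around `γ t`, and let `(eᵢ)` be its local frame. Writing
`V s = ∑ᵢ wⁱ(s) eᵢ(γ s)`, the covariant derivative is
`∑ᵢ (wⁱ)'(t) eᵢ(γ t) + ∑ᵢ wⁱ(t) (∇_{γ'(t)} eᵢ)(γ t)`; `FiberBundle.extend (E d) (V t)` is the local
section `∑ᵢ wⁱ(t) eᵢ`, whose coefficients in the frame are constant. -/
def covDerivAlong (nabla : AffineConnection d M)
    (γ : ℝ → M) (V : ∀ t : ℝ, TangentSpace (𝓡 d) (γ t)) (t : ℝ) : TangentSpace (𝓡 d) (γ t) :=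
  let e := trivializationAt (E d) (TangentSpace (𝓡 d) : M → Type _) (γ t)
  e.symm (γ t) (deriv (fun s ↦ (e ⟨γ s, V s⟩).2) t)
    + nabla (FiberBundle.extend (E d) (V t)) (γ t) (mfderiv 𝓘(ℝ, ℝ) (𝓡 d) γ t (1 : ℝ))

/-- `V` is a parallel vector field along the piecewise smooth curve `γ|_[0,1]`: it is continuous,
and except at finitely many times it is differentiable with `∇_{γ'} V = 0`. -/
def IsParallelAlong (nabla : AffineConnection d M)
    (γ : ℝ → M) (V : ∀ t : ℝ, TangentSpace (𝓡 d) (γ t)) : Prop :=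
  ContinuousOn (fun t ↦ (⟨γ t, V t⟩ : TangentBundle (𝓡 d) M)) (Icc 0 1) ∧
  ∃ S : Finset ℝ, ∀ t ∈ Ioo (0 : ℝ) 1, t ∉ S →
    MDifferentiableAt 𝓘(ℝ, ℝ) (𝓡 d).tangent (fun s ↦ (⟨γ s, V s⟩ : TangentBundle (𝓡 d) M)) t ∧
    covDerivAlong nabla γ V t = 0

/-- `c : T_pM → T_pM` is the holonomy of `∇` along the closed curve `γ` based at `p`: every `v` is
the initial value of a parallel field along `γ`, and each such field has final value `c v`.
For the Levi-Civita connection of a body with discrete defects, `c` is the disclination content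
of `γ`. -/
def IsHolonomy (nabla : AffineConnection d M)
    (γ : ℝ → M) (p : M) (c : TangentSpace (𝓡 d) p →L[ℝ] TangentSpace (𝓡 d) p) : Prop :=
  ∀ v : TangentSpace (𝓡 d) p,
    (∃ V, IsParallelAlong nabla γ V ∧
      (⟨γ 0, V 0⟩ : TangentBundle (𝓡 d) M) = ⟨p, v⟩) ∧
    ∀ V, IsParallelAlong nabla γ V → (⟨γ 0, V 0⟩ : TangentBundle (𝓡 d) M) = ⟨p, v⟩ →
      (⟨γ 1, V 1⟩ : TangentBundle (𝓡 d) M) = ⟨p, c v⟩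

end DefectBody

end

noncomputable section

namespace DefectBody

open Filter Topology

variable {d : ℕ} {M : Type*} [TopologicalSpace M] [ChartedSpace (E d) M]
  [IsManifold (𝓡 d) ∞ M]

/-! Over `U α` the coframe `P α` defines a flat connection, obtained by differentiating after
applying `P α` and mapping back. Its torsion is `dP_α` read through `P α`, hence zero, and it
preserves `G` because `P α` carries `G` to the Euclidean inner product. Every Levi-Civita connection
agrees with it on differentiable fields (`nabla_frameField`, `nabla_eq_flatDeriv`).

A field `V` along a curve in `U α` is therefore parallel exactly when `P α V` is constant
(`apply_covDerivAlong`), so transport from `γ a` to `γ b` is `P_α(γ b)⁻¹ ∘ P_α(γ a)`. Cutting a loop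
into pieces lying in single neighborhoods makes the holonomy, read in `P α`, a product of transition
maps `P_β ∘ P_α⁻¹`. Each of these is a symmetry of the archetype by `transition_mem`.
Undistortedness enters only through the independence of the metric from the reference map. -/

/-! ### Smooth coframes -/

/-- Smoothness of the `ℝᵈ`-valued one-form `θ` on the open set `U`. -/
structure IsSmoothCoframeOn (θ : ∀ p : M, TangentSpace (𝓡 d) p ≃L[ℝ] E d) (U : Set M) : Prop where
  isOpen : IsOpen U
  contMDiffOn : ContMDiffOn (𝓡 d).tangent 𝓘(ℝ, E d) ∞
    (fun v : TangentBundle (𝓡 d) M ↦ θ v.proj v.2) {v | v.proj ∈ U}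

/-- The one-form `θ` read in the trivialization of `TM` around `p`. -/
def localForm (θ : ∀ p : M, TangentSpace (𝓡 d) p ≃L[ℝ] E d) (p q : M) : E d →L[ℝ] E d :=
  (θ q : TangentSpace (𝓡 d) q →L[ℝ] E d) ∘L
    (trivializationAt (E d) (TangentSpace (𝓡 d) : M → Type _) p).symmL ℝ q

omit [IsManifold (𝓡 d) ∞ M] in
/-- A map into the continuous endomorphisms of `ℝᵈ` is smooth if it is pointwise smooth. -/
theorem contMDiffAt_clm_of_apply {A : M → E d →L[ℝ] E d} {p : M}
    (h : ∀ w, ContMDiffAt (𝓡 d) 𝓘(ℝ, E d) ∞ (fun q ↦ A q w) p) :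
    ContMDiffAt (𝓡 d) 𝓘(ℝ, E d →L[ℝ] E d) ∞ A p := by
  let b := EuclideanSpace.basisFun (Fin d) ℝ
  -- Expansion in an orthonormal basis, `A = ∑ ⟨bᵢ, ·⟩ A bᵢ`, leaves only the finitely many smooth
  -- maps `A bᵢ`.
  have hA : A = fun q ↦ ∑ i, ContinuousLinearMap.smulRightL ℝ (E d) (E d)
      (innerSL ℝ (b i)) (A q (b i)) := by
    funext q
    ext1 w
    conv_lhs => rw [← b.sum_repr' w]
    simp [-EuclideanSpace.basisFun_apply, -EuclideanSpace.basisFun_inner]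
  rw [hA]
  refine contMDiffAt_finsetSum fun i _ ↦ ?_
  exact (ContinuousLinearMap.contMDiffAt _).comp p (h (b i))

namespace IsSmoothCoframeOn

variable {θ : ∀ p : M, TangentSpace (𝓡 d) p ≃L[ℝ] E d} {U : Set M} {p : M}

theorem contMDiffAt (hθ : IsSmoothCoframeOn θ U) {v : TangentBundle (𝓡 d) M} (hv : v.proj ∈ U) :
    ContMDiffAt (𝓡 d).tangent 𝓘(ℝ, E d) ∞ (fun v : TangentBundle (𝓡 d) M ↦ θ v.proj v.2) v :=
  hθ.contMDiffOn.contMDiffAt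
    ((hθ.isOpen.preimage (FiberBundle.continuous_proj (E d) _)).mem_nhds hv)

/-- Sections with constant coefficients in the trivialization are smooth, and `θ` sends smooth
sections to smooth functions. -/
theorem contMDiffAt_localForm (hθ : IsSmoothCoframeOn θ U) (hp : p ∈ U) :
    ContMDiffAt (𝓡 d) 𝓘(ℝ, E d →L[ℝ] E d) ∞ (localForm θ p) p := by
  refine contMDiffAt_clm_of_apply fun w ↦ ?_
  let e := trivializationAt (E d) (TangentSpace (𝓡 d) : M → Type _) p
  have h1 : ContMDiffAt (𝓡 d) (𝓡 d).tangent ∞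
      (fun q ↦ (⟨q, e.symmL ℝ q w⟩ : TangentBundle (𝓡 d) M)) p := by
    refine (contMDiffAt_section p).2 ?_
    refine (contMDiffAt_const (c := w)).congr_of_eventuallyEq ?_
    filter_upwards [e.open_baseSet.mem_nhds (mem_baseSet_trivializationAt (E d) _ p)] with q hq
    simpa [e.coe_linearMapAt_of_mem hq] using e.continuousLinearMapAt_symmL (R := ℝ) hq w
  exact ContMDiffAt.comp p (hθ.contMDiffAt (v := ⟨p, _⟩) hp) h1

theorem apply_eq_localForm {q : M}
    (hq : q ∈ (trivializationAt (E d) (TangentSpace (𝓡 d) : M → Type _) p).baseSet)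
    (v : TangentSpace (𝓡 d) q) :
    θ q v = localForm θ p q
      (trivializationAt (E d) (TangentSpace (𝓡 d) : M → Type _) p ⟨q, v⟩).2 := by
  set e := trivializationAt (E d) (TangentSpace (𝓡 d) : M → Type _) p
  have h := e.symmL_continuousLinearMapAt (R := ℝ) hq v
  rw [e.continuousLinearMapAt_apply ℝ, e.coe_linearMapAt_of_mem hq] at h
  exact congrArg (θ q) h.symm

/-- `localForm` is invertible over the base set of the trivialization. -/
def localFormEquiv (θ : ∀ p : M, TangentSpace (𝓡 d) p ≃L[ℝ] E d) {q : M}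
    (hq : q ∈ (trivializationAt (E d) (TangentSpace (𝓡 d) : M → Type _) p).baseSet) :
    E d ≃L[ℝ] E d :=
  ((trivializationAt (E d) (TangentSpace (𝓡 d) : M → Type _) p).continuousLinearEquivAt
    ℝ q hq).symm.trans (θ q)

theorem coe_localFormEquiv {q : M}
    (hq : q ∈ (trivializationAt (E d) (TangentSpace (𝓡 d) : M → Type _) p).baseSet) :
    (localFormEquiv θ hq : E d →L[ℝ] E d) = localForm θ p q := by
  rw [localForm, ← Trivialization.symm_continuousLinearEquivAt_eq' _ hq]
  rfl

/-- The inverse `(q, w) ↦ θ_q⁻¹ w` of a smooth coframe is smooth. -/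
theorem contMDiffAt_symm (hθ : IsSmoothCoframeOn θ U) (hp : p ∈ U) (w : E d) :
    ContMDiffAt ((𝓡 d).prod 𝓘(ℝ, E d)) (𝓡 d).tangent ∞
      (fun x : M × E d ↦ (⟨x.1, (θ x.1).symm x.2⟩ : TangentBundle (𝓡 d) M)) (p, w) := by
  refine contMDiffAt_totalSpace.2 ⟨contMDiffAt_fst, ?_⟩
  set e := trivializationAt (E d) (TangentSpace (𝓡 d) : M → Type _) p
  have hpe : p ∈ e.baseSet := mem_baseSet_trivializationAt (E d) _ p
  have h1 : ContMDiffAt (𝓡 d) 𝓘(ℝ, E d →L[ℝ] E d) ∞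
      (fun q ↦ (localForm θ p q).inverse) p := by
    -- `ContinuousLinearMap.inverse` is total, but smooth only at invertible operators, such as the
    -- local form at `p`.
    have h0 : ContDiffAt ℝ ∞ ContinuousLinearMap.inverse (localForm θ p p) := by
      rw [← coe_localFormEquiv hpe]
      exact contDiffAt_map_inverse _
    exact h0.comp_contMDiffAt (hθ.contMDiffAt_localForm hp)
  have h2 : ContMDiffAt ((𝓡 d).prod 𝓘(ℝ, E d)) 𝓘(ℝ, E d) ∞
      (fun x : M × E d ↦ (localForm θ p x.1).inverse x.2) (p, w) :=
    ContMDiffAt.clm_apply (ContMDiffAt.comp (p, w) h1 contMDiffAt_fst) contMDiffAt_snd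
  refine h2.congr_of_eventuallyEq ?_
  filter_upwards [continuousAt_fst.preimage_mem_nhds (e.open_baseSet.mem_nhds hpe)] with x hx
  rw [← coe_localFormEquiv hx, ContinuousLinearMap.inverse_equiv]
  symm
  refine (ContinuousLinearEquiv.symm_apply_eq _).2 ?_
  have h3 := apply_eq_localForm (θ := θ) hx ((θ x.1).symm x.2)
  rw [← coe_localFormEquiv hx, ContinuousLinearEquiv.apply_symm_apply] at h3
  exact h3

/-- A field `V` along a map `f` is differentiable if `θ(V)` is. -/
theorem mdifferentiableAt_of_apply {H F N : Type*} [NormedAddCommGroup F] [NormedSpace ℝ F]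
    [TopologicalSpace H] {I : ModelWithCorners ℝ F H} [TopologicalSpace N] [ChartedSpace H N]
    (hθ : IsSmoothCoframeOn θ U) {f : N → M} {V : ∀ x, TangentSpace (𝓡 d) (f x)} {x : N}
    (hx : f x ∈ U) (hf : MDifferentiableAt I (𝓡 d) f x)
    (h : MDifferentiableAt I 𝓘(ℝ, E d) (fun y ↦ θ (f y) (V y)) x) :
    MDifferentiableAt I (𝓡 d).tangent (fun y ↦ (⟨f y, V y⟩ : TangentBundle (𝓡 d) M)) x := by
  -- `V = θ⁻¹(θ V)` is the smooth inverse coframe composed with the differentiable pair `(f, θ V)`.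
  have h1 := ((hθ.contMDiffAt_symm hx (θ (f x) (V x))).mdifferentiableAt (by simp)).comp x
    (hf.prodMk h)
  refine h1.congr_of_eventuallyEq (Eventually.of_forall fun y ↦ ?_)
  simp

theorem mdifferentiableAt_apply {H F N : Type*} [NormedAddCommGroup F] [NormedSpace ℝ F]
    [TopologicalSpace H] {I : ModelWithCorners ℝ F H} [TopologicalSpace N] [ChartedSpace H N]
    (hθ : IsSmoothCoframeOn θ U) {f : N → M} {V : ∀ x, TangentSpace (𝓡 d) (f x)} {x : N}
    (hx : f x ∈ U)
    (h : MDifferentiableAt I (𝓡 d).tangent (fun y ↦ (⟨f y, V y⟩ : TangentBundle (𝓡 d) M)) x) :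
    MDifferentiableAt I 𝓘(ℝ, E d) (fun y ↦ θ (f y) (V y)) x :=
  ((hθ.contMDiffAt (v := ⟨f x, V x⟩) hx).mdifferentiableAt (by simp)).comp x h

theorem continuousWithinAt_of_apply {N : Type*} [TopologicalSpace N]
    (hθ : IsSmoothCoframeOn θ U) {f : N → M} {V : ∀ x, TangentSpace (𝓡 d) (f x)} {x : N}
    {s : Set N} (hx : f x ∈ U) (hf : ContinuousWithinAt f s x)
    (h : ContinuousWithinAt (fun y ↦ θ (f y) (V y)) s x) :
    ContinuousWithinAt (fun y ↦ (⟨f y, V y⟩ : TangentBundle (𝓡 d) M)) s x := by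
  have h1 := ContinuousAt.comp_continuousWithinAt (f := fun y ↦ (f y, θ (f y) (V y)))
    (hθ.contMDiffAt_symm hx (θ (f x) (V x))).continuousAt (hf.prodMk h)
  refine h1.congr (fun y _ ↦ ?_) ?_ <;> simp

theorem continuousWithinAt_apply {N : Type*} [TopologicalSpace N]
    (hθ : IsSmoothCoframeOn θ U) {f : N → M} {V : ∀ x, TangentSpace (𝓡 d) (f x)} {x : N}
    {s : Set N} (hx : f x ∈ U)
    (h : ContinuousWithinAt (fun y ↦ (⟨f y, V y⟩ : TangentBundle (𝓡 d) M)) s x) :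
    ContinuousWithinAt (fun y ↦ θ (f y) (V y)) s x :=
  ContinuousAt.comp_continuousWithinAt (f := fun y ↦ (⟨f y, V y⟩ : TangentBundle (𝓡 d) M))
    (hθ.contMDiffAt (v := ⟨f x, V x⟩) hx).continuousAt h

end IsSmoothCoframeOn

/-! ### The flat connection of a coframe -/

/-- The flat connection `∇_v σ = θ⁻¹(v(θ(σ)))` for which the coframe `θ` is parallel. -/
def flatDeriv (θ : ∀ p : M, TangentSpace (𝓡 d) p ≃L[ℝ] E d)
    (σ : ∀ p : M, TangentSpace (𝓡 d) p) (p : M) :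
    TangentSpace (𝓡 d) p →L[ℝ] TangentSpace (𝓡 d) p :=
  ((θ p).symm : E d →L[ℝ] TangentSpace (𝓡 d) p) ∘L mvfderiv (𝓡 d) (fun q ↦ θ q (σ q)) p

variable {θ : ∀ p : M, TangentSpace (𝓡 d) p ≃L[ℝ] E d} {U : Set M} {p : M}

omit [IsManifold (𝓡 d) ∞ M] in
@[simp]
theorem apply_flatDeriv (σ : ∀ p : M, TangentSpace (𝓡 d) p) (v : TangentSpace (𝓡 d) p) :
    θ p (flatDeriv θ σ p v) = mvfderiv (𝓡 d) (fun q ↦ θ q (σ q)) p v :=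
  (θ p).apply_symm_apply _

theorem IsSmoothCoframeOn.mdifferentiableAt_section_apply (hθ : IsSmoothCoframeOn θ U)
    (hp : p ∈ U) {σ : ∀ p : M, TangentSpace (𝓡 d) p}
    (hσ : MDifferentiableAt (𝓡 d) (𝓡 d).tangent
      (fun q ↦ (⟨q, σ q⟩ : TangentBundle (𝓡 d) M)) p) :
    MDifferentiableAt (𝓡 d) 𝓘(ℝ, E d) (fun q ↦ θ q (σ q)) p :=
  hθ.mdifferentiableAt_apply (f := id) hp hσ

theorem isCovariantDerivativeOn_flatDeriv (hθ : IsSmoothCoframeOn θ U) :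
    IsCovariantDerivativeOn (E d) (flatDeriv θ) U where
  add {σ τ p} hσ hτ hp := by
    have h := mvfderiv_fun_add (hθ.mdifferentiableAt_section_apply hp hσ)
      (hθ.mdifferentiableAt_section_apply hp hτ)
    ext1 v
    apply (θ p).injective
    simpa using congr($h v)
  leibniz {σ g p} hσ hg hp := by
    have h := mvfderiv_fun_smul hg (hθ.mdifferentiableAt_section_apply hp hσ)
    ext1 v
    apply (θ p).injective
    simpa using congr($h v)

/-- The field `θ⁻¹ w` of the frame dual to the coframe `θ`. -/
def frameField (θ : ∀ p : M, TangentSpace (𝓡 d) p ≃L[ℝ] E d) (w : E d) (p : M) :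
    TangentSpace (𝓡 d) p := (θ p).symm w

theorem mdifferentiableAt_frameField (hθ : IsSmoothCoframeOn θ U) (hp : p ∈ U) (w : E d) :
    MDifferentiableAt (𝓡 d) (𝓡 d).tangent
      (fun q ↦ (⟨q, frameField θ w q⟩ : TangentBundle (𝓡 d) M)) p := by
  refine hθ.mdifferentiableAt_of_apply (f := id) hp mdifferentiableAt_id ?_
  simpa [frameField] using mdifferentiableAt_const

omit [IsManifold (𝓡 d) ∞ M] in
@[simp]
theorem flatDeriv_frameField (w : E d) : flatDeriv θ (frameField θ w) p = 0 := by
  simp [flatDeriv, frameField, mvfderiv_const]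

omit [IsManifold (𝓡 d) ∞ M] in
theorem mvfderiv_inner {f g : M → E d} (hf : MDifferentiableAt (𝓡 d) 𝓘(ℝ, E d) f p)
    (hg : MDifferentiableAt (𝓡 d) 𝓘(ℝ, E d) g p) (v : TangentSpace (𝓡 d) p) :
    mvfderiv (𝓡 d) (fun q ↦ inner ℝ (f q) (g q)) p v
      = inner ℝ (mvfderiv (𝓡 d) f p v) (g p) + inner ℝ (f p) (mvfderiv (𝓡 d) g p v) := by
  have h1 : HasFDerivAt (fun x : E d × E d ↦ inner ℝ x.1 x.2) _ (f p, g p) :=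
    (hasFDerivAt_fst).inner ℝ hasFDerivAt_snd
  have hfg : HasMFDerivAt (𝓡 d) 𝓘(ℝ, E d × E d) (fun q ↦ (f q, g q)) p
      ((mvfderiv (𝓡 d) f p).prod (mvfderiv (𝓡 d) g p)) :=
    ⟨hf.continuousAt.prodMk hg.continuousAt, hf.hasMFDerivAt.2.prodMk hg.hasMFDerivAt.2⟩
  have h2 := HasMFDerivAt.comp (f := fun q ↦ (f q, g q)) p h1.hasMFDerivAt hfg
  have h3 : mvfderiv (𝓡 d) (fun q ↦ inner ℝ (f q) (g q)) p v =
      inner ℝ (f p) (mvfderiv (𝓡 d) g p v) + inner ℝ (mvfderiv (𝓡 d) f p v) (g p) :=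
    congr($(h2.mfderiv) v)
  rw [h3, add_comm]

/-! ### The Levi-Civita connection of a body with discrete defects -/

namespace UniformRepresentation

variable {B : HyperelasticBody d M} {ι : Type*} (R : UniformRepresentation B ι)

theorem isSmoothCoframeOn (α : ι) : IsSmoothCoframeOn (R.P α) (R.U α) :=
  ⟨R.isOpen_U α, R.smooth_P α⟩

/-- The connection which at `p` is the flat connection of some `P_α` with `p ∈ U_α`. -/
def connection : AffineConnection d M where
  toFun σ p := flatDeriv (R.P (R.exists_mem_U p).choose) σ p
  isCovariantDerivativeOnUniv :=
    -- The axioms are checked one point at a time, so the index may depend on the point without any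
    -- compatibility between the choices.
    { add := fun {_ _ p} hσ hτ _ ↦ (isCovariantDerivativeOn_flatDeriv
        (R.isSmoothCoframeOn _)).add hσ hτ (R.exists_mem_U p).choose_spec
      leibniz := fun {_ _ p} hσ hg _ ↦ (isCovariantDerivativeOn_flatDeriv
        (R.isSmoothCoframeOn _)).leibniz hσ hg (R.exists_mem_U p).choose_spec }

variable {R}

/-- The index hidden in `metric` may jump from point to point; near `p` it can be replaced by a
fixed `α`, so that derivatives can be computed. -/
theorem mvfderiv_metric (h𝒲 : R.𝒲.IsUndistorted) {α : ι} {p : M} (hp : p ∈ R.U α)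
    (σ τ : ∀ q : M, TangentSpace (𝓡 d) q) :
    mvfderiv (𝓡 d) (fun q ↦ R.metric q (σ q) (τ q)) p
      = mvfderiv (𝓡 d) (fun q ↦ inner ℝ (R.P α q (σ q)) (R.P α q (τ q))) p := by
  have h : (fun q ↦ R.metric q (σ q) (τ q)) =ᶠ[𝓝 p]
      fun q ↦ inner ℝ (R.P α q (σ q)) (R.P α q (τ q)) := by
    filter_upwards [(R.isOpen_U α).mem_nhds hp] with q hq
    exact R.metric_eq h𝒲 hq _ _
  exact h.mfderiv_eq

/-- Torsion-freeness is `dP_α = 0` after applying `P_α`; metric compatibility is the product rule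
for the Euclidean inner product. -/
theorem isLeviCivita_connection (h𝒲 : R.𝒲.IsUndistorted) (hR : R.HasDiscreteDefects) :
    IsLeviCivita R.metric R.connection := by
  refine ⟨(CovariantDerivative.torsion_eq_zero_iff _).2 fun {X Y p} hX hY ↦ ?_,
    fun p v σ τ hσ hτ ↦ ?_⟩ <;>
  obtain ⟨α, hα⟩ : ∃ α, (R.exists_mem_U p).choose = α := ⟨_, rfl⟩ <;>
  have hp : p ∈ R.U α := hα ▸ (R.exists_mem_U p).choose_spec
  · have hc : ∀ σ, R.connection σ p = flatDeriv (R.P α) σ p := fun σ ↦ by rw [← hα]; rfl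
    apply (R.P α p).injective
    rw [hc, hc, map_sub, apply_flatDeriv, apply_flatDeriv]
    exact sub_eq_zero.1 (hR α p hp X Y hX hY)
  · have hc : ∀ σ, R.connection σ p = flatDeriv (R.P α) σ p := fun σ ↦ by rw [← hα]; rfl
    rw [mvfderiv_metric h𝒲 hp, R.metric_eq h𝒲 hp, R.metric_eq h𝒲 hp, hc, hc, apply_flatDeriv,
      apply_flatDeriv]
    exact mvfderiv_inner ((R.isSmoothCoframeOn α).mdifferentiableAt_section_apply hp hσ)
      ((R.isSmoothCoframeOn α).mdifferentiableAt_section_apply hp hτ) v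

/-- The frame dual to `P_α` is parallel for every Levi-Civita connection. -/
theorem nabla_frameField (h𝒲 : R.𝒲.IsUndistorted) (hR : R.HasDiscreteDefects)
    {nabla : AffineConnection d M} (h : IsLeviCivita R.metric nabla) {α : ι} {p : M}
    (hp : p ∈ R.U α) (w : E d) : nabla (frameField (R.P α) w) p = 0 := by
  have hs := mdifferentiableAt_frameField (R.isSmoothCoframeOn α) hp
  let s := frameField (R.P α)
  let a (x y z : E d) : ℝ := inner ℝ (R.P α p (nabla (s y) p (s x p))) z
  have hP : ∀ x q, R.P α q (s x q) = x := fun x q ↦ (R.P α q).apply_symm_apply x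
  -- On frame fields the functions `P_α(s x)` are constant, so `dP_α = 0` says that the fields
  -- commute; zero torsion then gives the symmetry.
  have hsymm : ∀ x y z, a x y z = a y x z := by
    intro x y z
    have h1 := (CovariantDerivative.torsion_eq_zero_iff _).1 h.1 (hs x) (hs y)
    have h2 := hR α p hp _ _ (hs x) (hs y)
    rw [← h1] at h2
    have h3 : R.P α p (nabla (s x) p (s y p) - nabla (s y) p (s x p)) = 0 := by
      simpa [s, frameField, mvfderiv_const] using h2
    rw [map_sub, sub_eq_zero] at h3
    exact congrArg (inner ℝ · z) h3.symm
  -- `G(s y, s z)` is the constant `⟨y, z⟩`, so its derivative vanishes.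
  have hskew : ∀ x y z, a x y z = - a x z y := by
    intro x y z
    have h1 := h.2 p (s x p) _ _ (hs y) (hs z)
    rw [mvfderiv_metric h𝒲 hp, R.metric_eq h𝒲 hp, R.metric_eq h𝒲 hp] at h1
    simp only [hP, s] at hP h1
    rw [mvfderiv_const, real_inner_comm _ y] at h1
    exact eq_neg_of_add_eq_zero_left h1.symm
  have ha : ∀ x y z, a x y z = 0 := by
    intro x y z
    -- Symmetry in the first two slots and skewness in the last two, alternated six times, give `a x
    -- y z = - a x y z`.
    linarith [hsymm x y z, hskew y x z, hsymm y z x, hskew z y x, hsymm z x y, hskew x z y]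
  ext1 v
  apply (R.P α p).injective
  have hv : v = s (R.P α p v) p := ((R.P α p).symm_apply_apply v).symm
  rw [hv]
  refine (ext_inner_right ℝ fun z ↦ ?_)
  simpa using ha _ w z

/-- Over `U_α` every Levi-Civita connection is the flat connection of `P_α`. -/
theorem nabla_eq_flatDeriv (h𝒲 : R.𝒲.IsUndistorted) (hR : R.HasDiscreteDefects)
    {nabla : AffineConnection d M} (h : IsLeviCivita R.metric nabla) {α : ι} {p : M}
    (hp : p ∈ R.U α) {σ : ∀ q : M, TangentSpace (𝓡 d) q}
    (hσ : MDifferentiableAt (𝓡 d) (𝓡 d).tangent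
      (fun q ↦ (⟨q, σ q⟩ : TangentBundle (𝓡 d) M)) p) :
    nabla σ p = flatDeriv (R.P α) σ p := by
  have hs := mdifferentiableAt_frameField (R.isSmoothCoframeOn α) hp
  have h1 := nabla.isCovariantDerivativeOn (s := R.U α)
  have h2 := isCovariantDerivativeOn_flatDeriv (R.isSmoothCoframeOn α)
  -- The difference of two connections is tensorial, so `σ` may be replaced by the frame field with
  -- the same value at `p`, which both connections annihilate.
  have h3 := IsCovariantDerivativeOn.difference_apply h1 h2 hp hσ
  have h4 := IsCovariantDerivativeOn.difference_apply h1 h2 hp (hs (R.P α p (σ p)))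
  rw [nabla_frameField h𝒲 hR h hp, flatDeriv_frameField, sub_zero] at h4
  have h5 : frameField (R.P α) (R.P α p (σ p)) p = σ p := (R.P α p).symm_apply_apply _
  rw [h5, h3] at h4
  exact sub_eq_zero.1 h4

/-- The reference map `P_α` turns the covariant derivative along a curve into the ordinary one. -/
theorem apply_covDerivAlong (h𝒲 : R.𝒲.IsUndistorted) (hR : R.HasDiscreteDefects)
    {nabla : AffineConnection d M} (h : IsLeviCivita R.metric nabla) {α : ι}
    {γ : ℝ → M} {V : ∀ t, TangentSpace (𝓡 d) (γ t)} {t : ℝ} (ht : γ t ∈ R.U α)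
    (hV : MDifferentiableAt 𝓘(ℝ, ℝ) (𝓡 d).tangent
      (fun s ↦ (⟨γ s, V s⟩ : TangentBundle (𝓡 d) M)) t) :
    R.P α (γ t) (covDerivAlong nabla γ V t) = deriv (fun s ↦ R.P α (γ s) (V s)) t := by
  set e := trivializationAt (E d) (TangentSpace (𝓡 d) : M → Type _) (γ t)
  have hpe : γ t ∈ e.baseSet := mem_baseSet_trivializationAt (E d) _ (γ t)
  obtain ⟨hγ, hw⟩ := (mdifferentiableAt_totalSpace _ _).1 hV
  let A := localForm (R.P α) (γ t)
  let w : ℝ → E d := fun s ↦ (e ⟨γ s, V s⟩).2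
  have hA : MDifferentiableAt (𝓡 d) 𝓘(ℝ, E d →L[ℝ] E d) A (γ t) :=
    ((R.isSmoothCoframeOn α).contMDiffAt_localForm ht).mdifferentiableAt (by simp)
  have hAγ : DifferentiableAt ℝ (fun s ↦ A (γ s)) t :=
    mdifferentiableAt_iff_differentiableAt.1 (hA.comp t hγ)
  have hw' : DifferentiableAt ℝ w t := mdifferentiableAt_iff_differentiableAt.1 hw
  have hnear : ∀ᶠ s in 𝓝 t, γ s ∈ e.baseSet :=
    hγ.continuousAt.preimage_mem_nhds (e.open_baseSet.mem_nhds hpe)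
  have h1 : (fun s ↦ R.P α (γ s) (V s)) =ᶠ[𝓝 t] fun s ↦ A (γ s) (w s) := by
    filter_upwards [hnear] with s hs using IsSmoothCoframeOn.apply_eq_localForm hs (V s)
  rw [h1.deriv_eq, deriv_clm_apply hAγ hw']
  have hext : MDifferentiableAt (𝓡 d) (𝓡 d).tangent
      (fun q ↦ (⟨q, FiberBundle.extend (E d) (V t) q⟩ : TangentBundle (𝓡 d) M)) (γ t) :=
    FiberBundle.mdifferentiableAt_extend ..
  have h2 := (R.isSmoothCoframeOn α).mdifferentiableAt_section_apply ht hext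
  rw [covDerivAlong, map_add, nabla_eq_flatDeriv h𝒲 hR h ht hext, apply_flatDeriv, add_comm]
  -- The product rule for `A(γ) w` matches term by term: the constant-coefficient extension accounts
  -- for the derivative of `A(γ)`, and `e.symm` for that of `w`.
  congr 1
  · have h3 : mvfderiv (𝓡 d) (fun q ↦ R.P α q (FiberBundle.extend (E d) (V t) q)) (γ t)
        (mfderiv 𝓘(ℝ, ℝ) (𝓡 d) γ t (1 : ℝ)) =
        deriv (fun s ↦ R.P α (γ s) (FiberBundle.extend (E d) (V t) (γ s))) t := by
      refine (mfderiv_comp_apply t h2 hγ (1 : ℝ)).symm.trans ?_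
      rw [mfderiv_eq_fderiv]
      rfl
    rw [h3]
    have h4 : (fun s ↦ R.P α (γ s) (FiberBundle.extend (E d) (V t) (γ s))) =ᶠ[𝓝 t]
        fun s ↦ A (γ s) (w t) := by
      filter_upwards [hnear] with s hs
      exact congrArg (R.P α (γ s)) (e.symmL_apply (R := ℝ) hs _).symm
    rw [h4.deriv_eq, deriv_clm_apply hAγ (differentiableAt_const _)]
    simp
  · exact congrArg (R.P α (γ t)) (e.symmL_apply (R := ℝ) hpe _).symm

end UniformRepresentation

/-! ### Parallel transport along intervals -/

variable (d) in
/-- `γ` is continuous on `[a, b]` and differentiable at all but finitely many times of `(a, b)`. -/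
def IsPiecewiseDifferentiableOn (γ : ℝ → M) (a b : ℝ) : Prop :=
  ContinuousOn γ (Icc a b) ∧
  ∃ S : Finset ℝ, ∀ t ∈ Ioo a b, t ∉ S → MDifferentiableAt 𝓘(ℝ, ℝ) (𝓡 d) γ t

omit [IsManifold (𝓡 d) ∞ M] in
theorem IsPiecewiseDifferentiableOn.mono {γ : ℝ → M} {a b a' b' : ℝ}
    (h : IsPiecewiseDifferentiableOn d γ a b) (ha : a ≤ a') (hb : b' ≤ b) :
    IsPiecewiseDifferentiableOn d γ a' b' := by
  obtain ⟨h1, S, hS⟩ := h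
  exact ⟨h1.mono (Icc_subset_Icc ha hb), S, fun t ht ↦ hS t (Ioo_subset_Ioo ha hb ht)⟩

omit [IsManifold (𝓡 d) ∞ M] in
theorem IsPiecewiseDifferentiableOn.trans {γ : ℝ → M} {a b c : ℝ} (hab : a ≤ b) (hbc : b ≤ c)
    (h : IsPiecewiseDifferentiableOn d γ a b) (h' : IsPiecewiseDifferentiableOn d γ b c) :
    IsPiecewiseDifferentiableOn d γ a c := by
  classical
  obtain ⟨h1, S, hS⟩ := h
  obtain ⟨h2, T, hT⟩ := h'
  -- The junction `b` joins the exceptional set, since the curve may have a corner there.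
  refine ⟨?_, insert b (S ∪ T), fun t ht htS ↦ ?_⟩
  · rw [← Icc_union_Icc_eq_Icc hab hbc]
    exact h1.union_of_isClosed h2 isClosed_Icc isClosed_Icc
  · simp only [Finset.mem_insert, Finset.mem_union, not_or] at htS
    rcases lt_or_gt_of_ne htS.1 with h | h
    exacts [hS t ⟨ht.1, h⟩ htS.2.1, hT t ⟨h, ht.2⟩ htS.2.2]

omit [IsManifold (𝓡 d) ∞ M] in
theorem IsPiecewiseSmoothLoop.isPiecewiseDifferentiableOn {γ : ℝ → M} {p : M}
    (h : IsPiecewiseSmoothLoop d γ p) : IsPiecewiseDifferentiableOn d γ 0 1 := by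
  obtain ⟨⟨n, t, ht, h0, h1, hγ⟩, -⟩ := h
  rw [← h0, ← h1]
  have key : ∀ k ≤ n, IsPiecewiseDifferentiableOn d γ (t 0) (t k) := by
    intro k
    induction k with
    | zero => exact fun _ ↦ ⟨by simp, ∅, by simp⟩
    | succ k ih =>
      intro hk
      refine (ih (by omega)).trans (ht.monotone k.zero_le) (ht.monotone k.le_succ) ?_
      refine ⟨(hγ k hk).continuousOn, ∅, fun s hs _ ↦ ?_⟩
      exact ((hγ k hk).contMDiffAt (Icc_mem_nhds hs.1 hs.2)).mdifferentiableAt (by simp)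
  exact key n le_rfl

/-- `V` is a parallel field along `γ|_[a,b]`. -/
def IsParallelOn (nabla : AffineConnection d M) (γ : ℝ → M)
    (V : ∀ t : ℝ, TangentSpace (𝓡 d) (γ t)) (a b : ℝ) : Prop :=
  ContinuousOn (fun t ↦ (⟨γ t, V t⟩ : TangentBundle (𝓡 d) M)) (Icc a b) ∧
  ∃ S : Finset ℝ, ∀ t ∈ Ioo a b, t ∉ S →
    MDifferentiableAt 𝓘(ℝ, ℝ) (𝓡 d).tangent (fun s ↦ (⟨γ s, V s⟩ : TangentBundle (𝓡 d) M)) t ∧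
    covDerivAlong nabla γ V t = 0

theorem IsParallelOn.mono {nabla : AffineConnection d M} {γ : ℝ → M}
    {V : ∀ t : ℝ, TangentSpace (𝓡 d) (γ t)} {a b a' b' : ℝ} (h : IsParallelOn nabla γ V a b)
    (ha : a ≤ a') (hb : b' ≤ b) : IsParallelOn nabla γ V a' b' := by
  obtain ⟨h1, S, hS⟩ := h
  exact ⟨h1.mono (Icc_subset_Icc ha hb), S, fun t ht ↦ hS t (Ioo_subset_Ioo ha hb ht)⟩

theorem covDerivAlong_congr {nabla : AffineConnection d M} {γ : ℝ → M}
    {V W : ∀ t : ℝ, TangentSpace (𝓡 d) (γ t)} {t : ℝ} (h : ∀ᶠ s in 𝓝 t, V s = W s) :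
    covDerivAlong nabla γ V t = covDerivAlong nabla γ W t := by
  have h1 : (fun s ↦ (trivializationAt (E d) (TangentSpace (𝓡 d) : M → Type _) (γ t)
      ⟨γ s, V s⟩).2) =ᶠ[𝓝 t] fun s ↦
      (trivializationAt (E d) (TangentSpace (𝓡 d) : M → Type _) (γ t) ⟨γ s, W s⟩).2 := by
    filter_upwards [h] with s hs
    rw [hs]
  simp only [covDerivAlong]
  rw [h1.deriv_eq, h.self_of_nhds]

theorem IsParallelOn.congr {nabla : AffineConnection d M} {γ : ℝ → M}
    {V W : ∀ t : ℝ, TangentSpace (𝓡 d) (γ t)} {a b : ℝ} (h : IsParallelOn nabla γ V a b)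
    (hVW : ∀ t ∈ Icc a b, W t = V t) : IsParallelOn nabla γ W a b := by
  obtain ⟨h1, S, hS⟩ := h
  refine ⟨h1.congr fun t ht ↦ by rw [hVW t ht], S, fun t ht htS ↦ ?_⟩
  have hev : ∀ᶠ s in 𝓝 t, W s = V s := by
    filter_upwards [Icc_mem_nhds ht.1 ht.2] with s hs using hVW s hs
  refine ⟨(hS t ht htS).1.congr_of_eventuallyEq ?_,
    (covDerivAlong_congr hev).trans (hS t ht htS).2⟩
  filter_upwards [hev] with s hs
  rw [hs]

theorem IsParallelOn.trans {nabla : AffineConnection d M} {γ : ℝ → M}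
    {V : ∀ t : ℝ, TangentSpace (𝓡 d) (γ t)} {a b c : ℝ} (hab : a ≤ b) (hbc : b ≤ c)
    (h : IsParallelOn nabla γ V a b) (h' : IsParallelOn nabla γ V b c) :
    IsParallelOn nabla γ V a c := by
  classical
  obtain ⟨h1, S, hS⟩ := h
  obtain ⟨h2, T, hT⟩ := h'
  refine ⟨?_, insert b (S ∪ T), fun t ht htS ↦ ?_⟩
  · rw [← Icc_union_Icc_eq_Icc hab hbc]
    exact h1.union_of_isClosed h2 isClosed_Icc isClosed_Icc
  · simp only [Finset.mem_insert, Finset.mem_union, not_or] at htS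
    rcases lt_or_gt_of_ne htS.1 with h | h
    exacts [hS t ⟨ht.1, h⟩ htS.2.1, hT t ⟨h, ht.2⟩ htS.2.2]

/-- A continuous function whose derivative vanishes off a finite set has equal end values. -/
theorem eq_of_deriv_eq_zero_off_finite {F : Type*} [NormedAddCommGroup F] [NormedSpace ℝ F]
    [CompleteSpace F] {f : ℝ → F} {a b : ℝ} (hab : a ≤ b) (hf : ContinuousOn f (Icc a b))
    (S : Finset ℝ) (h : ∀ t ∈ Ioo a b, t ∉ S → HasDerivAt f 0 t) : f b = f a := by
  have h1 := MeasureTheory.integral_eq_of_hasDerivAt_off_countable_of_le f (fun _ ↦ 0) hab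
    -- This is the fundamental theorem of calculus with a countable exceptional set, for the
    -- derivative zero.
    S.countable_toSet hf (fun t ht ↦ h t ht.1 (by simpa using ht.2)) (by simp)
  simpa [sub_eq_zero, eq_comm] using h1

/-! ### Transport operators as symmetries of the archetype -/

variable {B : HyperelasticBody d M} {ι : Type*}

/-- `T` is the parallel transport along `γ|_[a,b]`, up to the identification `γ b = q`, and in
terms of the reference maps it is a symmetry of the archetype. -/
structure IsTransport (R : UniformRepresentation B ι) (nabla : AffineConnection d M) (γ : ℝ → M)
    (a b : ℝ) (q : M) (T : TangentSpace (𝓡 d) (γ a) ≃L[ℝ] TangentSpace (𝓡 d) q) : Prop where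
  exists_parallel : ∀ v, ∃ V, IsParallelOn nabla γ V a b ∧ V a = v
  eq_of_parallel : ∀ V, IsParallelOn nabla γ V a b →
    (⟨γ b, V b⟩ : TangentBundle (𝓡 d) M) = ⟨q, T (V a)⟩
  mem_symmetryGroup : ∀ α β, γ a ∈ R.U α → q ∈ R.U β →
    ((R.P α (γ a)).symm.trans T).trans (R.P β q) ∈ symmetryGroup R.𝒲

variable {R : UniformRepresentation B ι} {nabla : AffineConnection d M} {γ : ℝ → M}

/-- Inside one `U α`, parallel fields are those with `P_α V` constant, which yields existence,
uniqueness and an explicit transport map. -/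
theorem exists_isTransport_of_subset (h𝒲 : R.𝒲.IsUndistorted) (hR : R.HasDiscreteDefects)
    (hnabla : IsLeviCivita R.metric nabla) {a b : ℝ} (hab : a ≤ b)
    (hγ : IsPiecewiseDifferentiableOn d γ a b) {α : ι} (hα : ∀ t ∈ Icc a b, γ t ∈ R.U α) :
    ∃ T, IsTransport R nabla γ a b (γ b) T := by
  have hP := R.isSmoothCoframeOn α
  obtain ⟨hcont, S, hS⟩ := hγ
  have ha := hα a (left_mem_Icc.2 hab)
  have hb := hα b (right_mem_Icc.2 hab)
  refine ⟨(R.P α (γ a)).trans (R.P α (γ b)).symm, ?_, ?_, ?_⟩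
  · intro v
    let V : ∀ t, TangentSpace (𝓡 d) (γ t) := fun t ↦ (R.P α (γ t)).symm (R.P α (γ a) v)
    have hV : (fun t ↦ R.P α (γ t) (V t)) = fun _ ↦ R.P α (γ a) v :=
      funext fun t ↦ (R.P α (γ t)).apply_symm_apply _
    refine ⟨V, ⟨fun t ht ↦ ?_, S, fun t ht htS ↦ ?_⟩, (R.P α (γ a)).symm_apply_apply v⟩
    · refine hP.continuousWithinAt_of_apply (hα t ht) (hcont t ht) ?_
      rw [hV]
      exact continuousWithinAt_const
    · have ht' := hα t (Ioo_subset_Icc_self ht)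
      have hd := hP.mdifferentiableAt_of_apply (V := V) ht' (hS t ht htS)
        (by rw [hV]; exact mdifferentiableAt_const)
      refine ⟨hd, (R.P α (γ t)).injective ?_⟩
      rw [UniformRepresentation.apply_covDerivAlong h𝒲 hR hnabla ht' hd, hV]
      simp
  · rintro V ⟨hV, S', hS'⟩
    have h1 : R.P α (γ b) (V b) = R.P α (γ a) (V a) := by
      refine eq_of_deriv_eq_zero_off_finite (f := fun t ↦ R.P α (γ t) (V t)) hab
        (fun t ht ↦ hP.continuousWithinAt_apply (hα t ht) (hV t ht)) S' fun t ht htS ↦ ?_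
      have ht' := hα t (Ioo_subset_Icc_self ht)
      obtain ⟨hd, h0⟩ := hS' t ht htS
      have h2 := UniformRepresentation.apply_covDerivAlong h𝒲 hR hnabla ht' hd
      rw [h0, map_zero] at h2
      rw [h2]
      exact (mdifferentiableAt_iff_differentiableAt.1
        (hP.mdifferentiableAt_apply ht' hd)).hasDerivAt
    congr 1
    exact ((R.P α (γ b)).symm_apply_eq.2 h1.symm).symm
  · intro β β' hβ hβ'
    -- In arbitrary reference maps at the two ends, transport is a transition `β → α` at `γ a`
    -- followed by a transition `α → β'` at `γ b`.
    have h := (symmetryGroup R.𝒲).mul_mem (R.transition_mem hβ' hb) (R.transition_mem ha hβ)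
    exact h

theorem IsTransport.trans {a b c : ℝ} (hab : a ≤ b) (hbc : b ≤ c)
    {T : TangentSpace (𝓡 d) (γ a) ≃L[ℝ] TangentSpace (𝓡 d) (γ b)}
    {T' : TangentSpace (𝓡 d) (γ b) ≃L[ℝ] TangentSpace (𝓡 d) (γ c)}
    (hT : IsTransport R nabla γ a b (γ b) T) (hT' : IsTransport R nabla γ b c (γ c) T') :
    IsTransport R nabla γ a c (γ c) (T.trans T') where
  exists_parallel v := by
    obtain ⟨V, hV, hVa⟩ := hT.exists_parallel v
    obtain ⟨W, hW, hWb⟩ := hT'.exists_parallel (V b)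
    -- The glued field also agrees with `W` at `b`, because `W` was chosen to start at `V b`.
    refine ⟨fun t ↦ if t ≤ b then V t else W t, IsParallelOn.trans hab hbc
      (hV.congr fun t ht ↦ if_pos ht.2) (hW.congr fun t ht ↦ ?_), (if_pos hab).trans hVa⟩
    rcases ht.1.eq_or_lt with rfl | h
    · exact (if_pos le_rfl).trans hWb.symm
    · exact if_neg h.not_ge
  eq_of_parallel V hV := by
    have h1 := TotalSpace.mk_injective _ (hT.eq_of_parallel V (hV.mono le_rfl hbc))
    rw [hT'.eq_of_parallel V (hV.mono hab le_rfl), h1]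
    rfl
  mem_symmetryGroup α β hα hβ := by
    -- Inserting `P_δ⁻¹ ∘ P_δ` at the junction splits the map into two factors already known to be
    -- symmetries.
    obtain ⟨δ, hδ⟩ := R.exists_mem_U (γ b)
    have h := (symmetryGroup R.𝒲).mul_mem (hT'.mem_symmetryGroup δ β hδ hβ)
      (hT.mem_symmetryGroup α δ hα hδ)
    convert h using 1
    refine ContinuousLinearEquiv.ext (funext fun x ↦ ?_)
    exact congrArg (fun y ↦ R.P β (γ c) (T' y))
      ((R.P δ (γ b)).symm_apply_apply (T ((R.P α (γ a)).symm x))).symm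

theorem exists_isTransport (h𝒲 : R.𝒲.IsUndistorted) (hR : R.HasDiscreteDefects)
    (hnabla : IsLeviCivita R.metric nabla) {a b : ℝ} (hab : a ≤ b)
    (hγ : IsPiecewiseDifferentiableOn d γ a b) :
    ∃ T, IsTransport R nabla γ a b (γ b) T := by
  have hc : Continuous (fun s : Icc a b ↦ γ s) := continuousOn_iff_continuous_domRestrict.1 hγ.1
  -- Compactness of `[a, b]` gives a subdivision, eventually constant equal to `b`, each piece of
  -- which `γ` maps into a single `U α`.
  obtain ⟨t, h0, hmono, ⟨n, hn⟩, hsub⟩ := exists_monotone_Icc_subset_open_cover_Icc hab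
    (c := fun α ↦ (fun s : Icc a b ↦ γ s) ⁻¹' R.U α) (fun α ↦ (R.isOpen_U α).preimage hc)
    (fun s _ ↦ mem_iUnion.2 (R.exists_mem_U (γ s)))
  have hpiece : ∀ k s, s ∈ Icc (t k : ℝ) (t (k + 1)) → ∃ h : s ∈ Icc a b,
      (⟨s, h⟩ : Icc a b) ∈ Icc (t k) (t (k + 1)) :=
    fun k s hs ↦ ⟨⟨(t k).2.1.trans hs.1, hs.2.trans (t (k + 1)).2.2⟩, hs⟩
  have key : ∀ k, ∃ T, IsTransport R nabla γ (t 0) (t k) (γ (t k)) T := by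
    intro k
    induction k with
    | zero =>
      obtain ⟨α, hα⟩ := R.exists_mem_U (γ (t 0))
      refine exists_isTransport_of_subset h𝒲 hR hnabla le_rfl
        (hγ.mono (t 0).2.1 (t 0).2.2) (α := α) fun s hs ↦ ?_
      rwa [le_antisymm hs.2 hs.1]
    | succ k ih =>
      obtain ⟨T, hT⟩ := ih
      obtain ⟨α, hα⟩ := hsub k
      obtain ⟨T', hT'⟩ := exists_isTransport_of_subset h𝒲 hR hnabla
        (show (t k : ℝ) ≤ t (k + 1) from hmono k.le_succ)
        (hγ.mono (t k).2.1 (t (k + 1)).2.2) (α := α) fun s hs ↦ by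
          obtain ⟨hs1, hs2⟩ := hpiece k s hs
          exact hα hs2
      exact ⟨_, hT.trans (show (t 0 : ℝ) ≤ t k from hmono k.zero_le)
        (show (t k : ℝ) ≤ t (k + 1) from hmono k.le_succ) hT'⟩
  have h := key n
  rwa [h0, hn n le_rfl] at h

end DefectBody

end

/-! ### Holonomy of a loop -/

theorem mainTheorem2 {d : ℕ} {M : Type*} [TopologicalSpace M]
    [ChartedSpace (DefectBody.E d) M] [IsManifold (𝓡 d) ∞ M]
    (B : DefectBody.HyperelasticBody d M) {ι : Type*}
    (R : DefectBody.UniformRepresentation B ι)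
    (hundistorted : R.𝒲.IsUndistorted) (hdefects : R.HasDiscreteDefects) :
    (∃ nabla : DefectBody.AffineConnection d M, DefectBody.IsLeviCivita R.metric nabla) ∧
    ∀ nabla : DefectBody.AffineConnection d M, DefectBody.IsLeviCivita R.metric nabla →
      ∀ (γ : ℝ → M) (p : M), DefectBody.IsPiecewiseSmoothLoop d γ p →
        (∃! c : TangentSpace (𝓡 d) p →L[ℝ] TangentSpace (𝓡 d) p, DefectBody.IsHolonomy nabla γ p c) ∧
        ∀ c : TangentSpace (𝓡 d) p →L[ℝ] TangentSpace (𝓡 d) p, DefectBody.IsHolonomy nabla γ p c →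
          ∀ α, p ∈ R.U α →
          ∃ g ∈ DefectBody.symmetryGroup R.𝒲,
            (g : DefectBody.E d →L[ℝ] DefectBody.E d) =
              (R.P α p : TangentSpace (𝓡 d) p →L[ℝ] DefectBody.E d) ∘L c ∘L
                ((R.P α p).symm : DefectBody.E d →L[ℝ] TangentSpace (𝓡 d) p) := by
  refine ⟨⟨R.connection, R.isLeviCivita_connection hundistorted hdefects⟩,
    fun nabla hnabla γ p hγ ↦ ?_⟩
  have hT := DefectBody.exists_isTransport hundistorted hdefects hnabla zero_le_one
    hγ.isPiecewiseDifferentiableOn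
  obtain ⟨-, rfl, h1⟩ := hγ
  -- The free endpoint `q` of `IsTransport` lets `γ 1` be replaced by `γ 0`, which makes `T` an
  -- automorphism of one tangent space.
  rw [h1] at hT
  obtain ⟨T, hT⟩ := hT
  have hholonomy : DefectBody.IsHolonomy nabla γ (γ 0)
      (T : TangentSpace (𝓡 d) (γ 0) →L[ℝ] TangentSpace (𝓡 d) (γ 0)) := by
    refine fun v ↦ ⟨?_, fun V hV hv ↦ ?_⟩
    · obtain ⟨V, hV, hv⟩ := hT.exists_parallel v
      exact ⟨V, hV, by rw [hv]⟩
    · rw [hT.eq_of_parallel V hV, TotalSpace.mk_injective _ hv]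
      rfl
  have hunique : ∀ c, DefectBody.IsHolonomy nabla γ (γ 0) c →
      c = (T : TangentSpace (𝓡 d) (γ 0) →L[ℝ] TangentSpace (𝓡 d) (γ 0)) := by
    intro c hc
    ext1 v
    obtain ⟨V, hV, hv⟩ := (hholonomy v).1
    -- A parallel field starting at `v` exists, and its final value determines both `c v` and `T v`.
    exact TotalSpace.mk_injective _
      (((hc v).2 V hV hv).symm.trans ((hholonomy v).2 V hV hv))
  refine ⟨⟨_, hholonomy, hunique⟩, fun c hc α hα ↦ ⟨_, hT.mem_symmetryGroup α α hα hα, ?_⟩⟩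
  rw [hunique c hc]
  rfl
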